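/- Let $V$ be a simple vertex algebra over $\mathbb{C}$ of countable dimension, let $G$ be a finite group of automorphisms of $V$, and let $\sigma$ be an element of the center of $G$, of order $T$. For $0\le r<T$ let $V^r=\{v\in V\mid \sigma v=e^{-2\pi i r/T}v\}$. A $\sigma$-twisted $V$-module is a complex vector space $M$ with a linear map $v\mapsto Y_M(v,z)=\sum_{n\in\frac1T\mathbb{Z}}v_nz^{-n-1}$, $v_n\in\mathrm{End}\,M$, such that for $0\le r<T$, $u\in V^r$, $v\in V$, $w\in M$: $u_n=0$ unless $n\in\frac rT+\mathbb{Z}$; $u_nw=0$ for $n\gg0$; $Y_M(\mathbf 1,z)=\mathrm{Id}_M$; and $$z_0^{-1}\delta\Big(\frac{z_1-z_2}{z_0}\Big)Y_M(u,z_1)Y_M(v,z_2)-z_0^{-1}\delta\Big(\frac{z_2-z_1}{-z_0}\Big)Y_M(v,z_2)Y_M(u,z_1)=z_2^{-1}\Big(\frac{z_1-z_0}{z_2}\Big)^{-r/T}\delta\Big(\frac{z_1-z_0}{z_2}\Big)Y_M(Y(u,z_0)v,z_2).$$ Let $M$ be an irreducible $\sigma$-twisted $V$-module that is $G$-stable: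 for every $g\in G$, $M$ is isomorphic, as a $\sigma$-twisted $V$-module, to $M\cdot g$, which is the space $M$ with $Y_{M\cdot g}(v,z)=Y_M(gv,z)$. Then there are invertible linear maps $\phi(g):M\to M$, $g\in G$, with $\phi(1)=\mathrm{Id}_M$ and $\phi(g)Y_M(v,z)\phi(g)^{-1}=Y_M(gv,z)$ for all $g\in G$, $v\in V$. For every such choice of $\phi$ there is a (necessarily unique) normalized 2-cocycle $\alpha_M:G\times G\to\mathbb{C}^*$ with $\phi(g)\phi(h)=\alpha_M(g,h)\phi(gh)$ for all $g,h\in G$. Let $\mathbb{C}^{\alpha_M}[G]=\bigoplus_{g\in G}\mathbb{C}\bar g$ be the twisted group algebra, with $\bar g\,\bar h=\alpha_M(g,h)\overline{gh}$, acting on $M$ by $\bar g\,w=\phi(g)w$. Then every simple $\mathbb{C}^{\alpha_M}[G]$-module appears in $M$, i.e. is isomorphic to a $\mathbb{C}^{\alpha_M}[G]$-submodule of $M$. -/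

import Mathlib

noncomputable section

/-! ### Vertex algebras -/

/-- A vertex algebra over `ℂ`. The vertex operator `Y(u,z) = ∑ u_n z^{-n-1}` is recorded by its modes
`u_n = mode u n`, that is, as an arbitrary two-sided formal series with coefficients in `End V`.
`jacobi` is the Jacobi identity, applied to `w`, with the coefficients of
`z₀^{-l-1} z₁^{-m-1} z₂^{-n-1}` compared; by `truncation` all the sums in it have finite support. -/
class VertexAlgebra (V : Type*) [AddCommGroup V] [Module ℂ V] where
  mode : V →ₗ[ℂ] ℤ → Module.End ℂ V
  vacuum : V
  truncation : ∀ u v : V, ∃ N : ℤ, ∀ n : ℤ, N ≤ n → mode u n v = 0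
  vacuum_mode : ∀ (n : ℤ) (v : V), mode vacuum n v = if n = -1 then v else 0
  creation : ∀ (v : V) (n : ℤ), 0 ≤ n → mode v n vacuum = 0
  creation_lim : ∀ v : V, mode v (-1) vacuum = v
  jacobi : ∀ (u v w : V) (l m n : ℤ),
    (∑ᶠ i : ℕ, ((-1 : ℂ) ^ i * ((Ring.choose l i : ℤ) : ℂ)) •
      (mode u (m + l - i) (mode v (n + i) w)
        - (-1 : ℂ) ^ l • mode v (n + l - i) (mode u (m + i) w)))
    = ∑ᶠ j : ℕ, ((Ring.choose m j : ℤ) : ℂ) • mode (mode u (l + j) v) (m + n - j) w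

namespace VertexAlgebra

variable (V : Type*) [AddCommGroup V] [Module ℂ V] [VertexAlgebra V]

/-- The automorphism group of a vertex algebra: invertible linear maps `g` with `g 𝟏 = 𝟏` and
`g Y(u,z) g⁻¹ = Y(g u, z)`. -/
def autSubgroup : Subgroup (V ≃ₗ[ℂ] V) where
  carrier := {g | g vacuum = vacuum ∧
    ∀ (u v : V) (n : ℤ), g (mode u n v) = mode (g u) n (g v)}
  one_mem' := ⟨rfl, fun _ _ _ => rfl⟩
  mul_mem' := by
    rintro a b ⟨ha, ha'⟩ ⟨hb, hb'⟩
    refine ⟨?_, fun u v n => ?_⟩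
    · simp only [LinearEquiv.mul_apply, hb, ha]
    · simp only [LinearEquiv.mul_apply, hb', ha']
  inv_mem' := by
    rintro a ⟨ha, ha'⟩
    refine ⟨a.injective ?_, fun u v n => a.injective ?_⟩
    · rw [← LinearEquiv.mul_apply, mul_inv_cancel, ha]; rfl
    · rw [ha', ← LinearEquiv.mul_apply, ← LinearEquiv.mul_apply, ← LinearEquiv.mul_apply,
        mul_inv_cancel]; rfl

/-- `Aut V`, as a type. -/
abbrev Aut : Type _ := ↥(autSubgroup V)

variable {V}

/-- A (two-sided) ideal of a vertex algebra. -/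
def IsIdeal (I : Submodule ℂ V) : Prop :=
  ∀ (v : V) (n : ℤ), ∀ w ∈ I, mode v n w ∈ I ∧ mode w n v ∈ I

variable (V) in
/-- A vertex algebra is simple if it is nonzero and its only ideals are `0` and itself. -/
def IsSimple : Prop :=
  Nontrivial V ∧ ∀ I : Submodule ℂ V, IsIdeal I → I = ⊥ ∨ I = ⊤

/-- `V^r`, the eigenspace of `σ` for the eigenvalue `e^{-2πir/T}`, where `T` is the order of `σ`. -/
def sector (σ : Aut V) (r : ℕ) : Submodule ℂ V :=
  Module.End.eigenspace ((σ : V ≃ₗ[ℂ] V) : V →ₗ[ℂ] V)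
    (Complex.exp (-2 * Real.pi * Complex.I * r / orderOf σ))

end VertexAlgebra

/-! ### Twisted modules -/

open VertexAlgebra in
/-- A structure of `σ`-twisted `V`-module on the vector space `M`, where `σ` is an automorphism of `V`
of finite order `T`. The vertex operator `Y_M(u,z) = ∑ u_n z^{-n-1}` is recorded by its modes
`u_n = mode u n`, indexed by rational numbers; by `support` those of `u ∈ V^r` vanish outside of
`r/T + ℤ`, so that in general only exponents in `(1/T)ℤ` occur. `jacobi` is the twisted Jacobi
identity, applied to `w`, with the coefficients of `z₀^{-l-1} z₁^{-m-1} z₂^{-n-1}` compared, where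
`m ∈ r/T + ℤ`: the coefficient of `z₁^{-m-1} z₀^j` in
`z₂^{-1} ((z₁-z₀)/z₂)^{-r/T} δ((z₁-z₀)/z₂)` is `(-1)^j (j-m-1 choose j) = (m choose j)` times
`z₂^{m-j}`. By `truncation` all the sums in it have finite support. -/
structure TwistedModule (V : Type*) [AddCommGroup V] [Module ℂ V] [VertexAlgebra V]
    (σ : Aut V) (M : Type*) [AddCommGroup M] [Module ℂ M] where
  mode : V →ₗ[ℂ] ℚ → Module.End ℂ M
  support : ∀ r < orderOf σ, ∀ u ∈ sector σ r, ∀ n : ℚ,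
    (¬ ∃ k : ℤ, n = (r : ℚ) / (orderOf σ : ℚ) + k) → mode u n = 0
  truncation : ∀ (u : V) (w : M), ∃ N : ℚ, ∀ n : ℚ, N ≤ n → mode u n w = 0
  vacuum_mode : ∀ (n : ℚ) (w : M), mode vacuum n w = if n = -1 then w else 0
  jacobi : ∀ r < orderOf σ, ∀ u ∈ sector σ r, ∀ (v : V) (w : M) (l : ℤ) (m n : ℚ),
    (∃ k : ℤ, m = (r : ℚ) / (orderOf σ : ℚ) + k) →
    (∑ᶠ i : ℕ, ((-1 : ℂ) ^ i * ((Ring.choose l i : ℤ) : ℂ)) •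
      (mode u (m + l - i) (mode v (n + i) w)
        - (-1 : ℂ) ^ l • mode v (n + l - i) (mode u (m + i) w)))
    = ∑ᶠ j : ℕ, ((Ring.choose m j : ℚ) : ℂ) •
        mode (VertexAlgebra.mode u (l + j) v) (m + n - j) w

namespace TwistedModule

open VertexAlgebra

variable {V : Type*} [AddCommGroup V] [Module ℂ V] [VertexAlgebra V] {σ : Aut V}
  {M : Type*} [AddCommGroup M] [Module ℂ M] {N : Type*} [AddCommGroup N] [Module ℂ N]

/-- `M` is an irreducible `σ`-twisted module: it is nonzero, and its only subspaces stable under all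
modes are `0` and `M`. -/
def IsIrreducible (Y : TwistedModule V σ M) : Prop :=
  Nontrivial M ∧ ∀ P : Submodule ℂ M,
    (∀ (v : V) (n : ℚ), ∀ w ∈ P, Y.mode v n w ∈ P) → P = ⊥ ∨ P = ⊤

/-- Isomorphism of `σ`-twisted modules. -/
def Isomorphic (Y : TwistedModule V σ M) (Y' : TwistedModule V σ N) : Prop :=
  ∃ f : M ≃ₗ[ℂ] N, ∀ (v : V) (n : ℚ) (w : M), f (Y.mode v n w) = Y'.mode v n (f w)

theorem apply_mem_sector {g : Aut V} (hg : Commute g σ) {r : ℕ} {u : V} (hu : u ∈ sector σ r) :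
    (g : V ≃ₗ[ℂ] V) u ∈ sector σ r := by
  have h1 : (σ : V ≃ₗ[ℂ] V) u = _ := Module.End.mem_eigenspace_iff.1 hu
  have h2 : (σ : V ≃ₗ[ℂ] V) ((g : V ≃ₗ[ℂ] V) u) = (g : V ≃ₗ[ℂ] V) ((σ : V ≃ₗ[ℂ] V) u) := by
    have h : ((σ * g : Aut V) : V ≃ₗ[ℂ] V) u = ((g * σ : Aut V) : V ≃ₗ[ℂ] V) u := by rw [hg.eq]
    exact h
  refine Module.End.mem_eigenspace_iff.2 ?_
  change (σ : V ≃ₗ[ℂ] V) ((g : V ≃ₗ[ℂ] V) u) = _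
  rw [h2, h1, map_smul]

/-- The `σ`-twisted module `M · g`, for `g` commuting with `σ`: the space `M` with
`Y_{M·g}(v,z) = Y_M(g v, z)`. -/
def conj (Y : TwistedModule V σ M) (g : Aut V) (hg : Commute g σ) : TwistedModule V σ M where
  mode := Y.mode ∘ₗ ((g : V ≃ₗ[ℂ] V) : V →ₗ[ℂ] V)
  support r hr u hu n hn := Y.support r hr _ (apply_mem_sector hg hu) n hn
  truncation u w := Y.truncation _ w
  vacuum_mode n w := by
    have h : (g : V ≃ₗ[ℂ] V) vacuum = vacuum := g.2.1
    simp only [LinearMap.comp_apply, LinearEquiv.coe_coe, h, Y.vacuum_mode]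
  jacobi r hr u hu v w l m n hm := by
    have h : ∀ (u v : V) (n : ℤ), (g : V ≃ₗ[ℂ] V) (VertexAlgebra.mode u n v)
        = VertexAlgebra.mode ((g : V ≃ₗ[ℂ] V) u) n ((g : V ≃ₗ[ℂ] V) v) := g.2.2
    simp only [LinearMap.comp_apply, LinearEquiv.coe_coe, h]
    exact Y.jacobi r hr _ (apply_mem_sector hg hu) _ w l m n hm

/-- `M` is `G`-stable: `M ≅ M · g` as `σ`-twisted modules for every `g ∈ G`. -/
def IsGStable (Y : TwistedModule V σ M) (G : Subgroup (Aut V)) (hσ : ∀ g ∈ G, Commute g σ) : Prop :=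
  ∀ (g : Aut V) (hg : g ∈ G), Y.Isomorphic (Y.conj g (hσ g hg))

/-- A choice, for each `g ∈ G`, of an invertible operator `φ g` on `M` with
`φ(g) Y_M(v,z) φ(g)⁻¹ = Y_M(g v, z)`, such that `φ 1 = Id`. -/
def IsIntertwiningFamily (Y : TwistedModule V σ M) (G : Subgroup (Aut V))
    (φ : G → (M ≃ₗ[ℂ] M)) : Prop :=
  φ 1 = LinearEquiv.refl ℂ M ∧
  ∀ (g : G) (v : V) (n : ℚ) (w : M),
    φ g (Y.mode v n w) = Y.mode (((g : Aut V) : V ≃ₗ[ℂ] V) v) n (φ g w)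

end TwistedModule

/-! ### Twisted group algebras -/

/-- A normalized 2-cocycle of `G` with values in `ℂˣ` (trivial action). -/
structure TwoCocycle (G : Type*) [Group G] where
  val : G → G → ℂˣ
  one_left : ∀ g, val 1 g = 1
  one_right : ∀ g, val g 1 = 1
  cocycle : ∀ g h k, val g h * val (g * h) k = val h k * val g (h * k)

/-- The twisted group algebra `ℂ^α[G]`: the vector space with basis `ḡ`, `g ∈ G`, and the
bilinear product with `ḡ h̄ = α(g,h) \overline{gh}`. -/
def TwistedGroupAlgebra {G : Type*} [Group G] (_α : TwoCocycle G) : Type _ := G →₀ ℂ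

namespace TwistedGroupAlgebra

variable {G : Type*} [Group G] {α : TwoCocycle G}

instance : AddCommGroup (TwistedGroupAlgebra α) := inferInstanceAs (AddCommGroup (G →₀ ℂ))
instance : Module ℂ (TwistedGroupAlgebra α) := inferInstanceAs (Module ℂ (G →₀ ℂ))

variable (α) in
/-- The basis element `ḡ`. -/
def bar (g : G) : TwistedGroupAlgebra α := Finsupp.single g (1 : ℂ)

variable (α) in
/-- The linear map with prescribed values on the `ḡ`. -/
def lift {E : Type*} [AddCommGroup E] [Module ℂ E] (f : G → E) : TwistedGroupAlgebra α →ₗ[ℂ] E :=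
  Finsupp.lift E ℂ G f

@[simp] theorem lift_bar {E : Type*} [AddCommGroup E] [Module ℂ E] (f : G → E) (g : G) :
    lift α f (bar α g) = f g := by
  have h : (Finsupp.lift E ℂ G f) (Finsupp.single g (1 : ℂ)) = f g := by simp
  exact h

theorem induction_bar {p : TwistedGroupAlgebra α → Prop} (a : TwistedGroupAlgebra α)
    (hbar : ∀ g, p (bar α g)) (hadd : ∀ a b, p a → p b → p (a + b))
    (hsmul : ∀ (c : ℂ) a, p a → p (c • a)) : p a := by
  have h0 : p 0 := by simpa using hsmul 0 _ (hbar 1)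
  refine Finsupp.induction_linear (motive := p) a h0 hadd fun g c => ?_
  have h : (Finsupp.single g c : G →₀ ℂ) = c • Finsupp.single g (1 : ℂ) := by simp
  rw [h]
  exact hsmul c _ (hbar g)

variable (α) in
/-- The product of `ℂ^α[G]`, as a bilinear map. -/
def mulBilin : TwistedGroupAlgebra α →ₗ[ℂ] TwistedGroupAlgebra α →ₗ[ℂ] TwistedGroupAlgebra α :=
  lift α fun g => lift α fun h => (α.val g h : ℂ) • bar α (g * h)

theorem mulBilin_bar (g h : G) :
    mulBilin α (bar α g) (bar α h) = (α.val g h : ℂ) • bar α (g * h) := by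
  simp [mulBilin]

theorem mulBilin_one (a : TwistedGroupAlgebra α) : mulBilin α (bar α 1) a = a := by
  induction a using induction_bar with
  | hbar g => rw [mulBilin_bar, α.one_left, one_mul]; simp
  | hadd a b ha hb => rw [map_add, ha, hb]
  | hsmul c a ha => rw [map_smul, ha]

theorem one_mulBilin (a : TwistedGroupAlgebra α) : mulBilin α a (bar α 1) = a := by
  induction a using induction_bar with
  | hbar g => rw [mulBilin_bar, α.one_right, mul_one]; simp
  | hadd a b ha hb => rw [map_add, LinearMap.add_apply, ha, hb]
  | hsmul c a ha => rw [map_smul, LinearMap.smul_apply, ha]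

theorem mulBilin_assoc (a b c : TwistedGroupAlgebra α) :
    mulBilin α (mulBilin α a b) c = mulBilin α a (mulBilin α b c) := by
  induction a using induction_bar with
  | hadd a a' ha hb => simp only [map_add, LinearMap.add_apply, ha, hb]
  | hsmul t a ha => simp only [map_smul, LinearMap.smul_apply, ha]
  | hbar g =>
    induction b using induction_bar with
    | hadd a a' ha hb => simp only [map_add, LinearMap.add_apply, ha, hb]
    | hsmul t a ha => simp only [map_smul, LinearMap.smul_apply, ha]
    | hbar h =>
      induction c using induction_bar with
      | hadd a a' ha hb => simp only [map_add, ha, hb]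
      | hsmul t a ha => simp only [map_smul, ha]
      | hbar k =>
        have e : (α.val g h : ℂ) * (α.val (g * h) k : ℂ)
            = (α.val h k : ℂ) * (α.val g (h * k) : ℂ) := by
          exact_mod_cast congrArg Units.val (α.cocycle g h k)
        simp only [mulBilin_bar, map_smul, LinearMap.smul_apply, smul_smul, e, mul_assoc]

instance : Ring (TwistedGroupAlgebra α) :=
  { (inferInstance : AddCommGroup (TwistedGroupAlgebra α)) with
    mul := fun a b => mulBilin α a b
    one := bar α 1
    left_distrib := fun a b c => map_add (mulBilin α a) b c
    right_distrib := fun a b c => LinearMap.map_add₂ (mulBilin α) a b c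
    zero_mul := fun a => LinearMap.map_zero₂ (mulBilin α) a
    mul_zero := fun a => map_zero (mulBilin α a)
    mul_assoc := mulBilin_assoc
    one_mul := mulBilin_one
    mul_one := one_mulBilin }

instance : Algebra ℂ (TwistedGroupAlgebra α) :=
  Algebra.ofModule (fun t a b => LinearMap.map_smul₂ (mulBilin α) t a b)
    (fun t a b => map_smul (mulBilin α a) t b)

theorem one_def : (1 : TwistedGroupAlgebra α) = bar α 1 := rfl

theorem bar_mul_bar (g h : G) : bar α g * bar α h = (α.val g h : ℂ) • bar α (g * h) :=
  mulBilin_bar g h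

/-- A projective representation `φ` of `G` on `M` with 2-cocycle `α`, as a representation of the
algebra `ℂ^α[G]`: the element `ḡ` acts as `φ g`. -/
def rep {M : Type*} [AddCommGroup M] [Module ℂ M] (φ : G → (M ≃ₗ[ℂ] M))
    (h1 : φ 1 = LinearEquiv.refl ℂ M)
    (hα : ∀ (g h : G) (w : M), φ g (φ h w) = (α.val g h : ℂ) • φ (g * h) w) :
    TwistedGroupAlgebra α →ₐ[ℂ] Module.End ℂ M :=
  AlgHom.ofLinearMap (lift α fun g => (φ g : Module.End ℂ M))
    (by rw [one_def, lift_bar, h1]; rfl)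
    (by
      intro a b
      induction a using induction_bar with
      | hadd a a' ha hb => simp only [map_add, add_mul, ha, hb]
      | hsmul t a ha => simp only [map_smul, smul_mul_assoc, ha]
      | hbar g =>
        induction b using induction_bar with
        | hadd a a' ha hb => simp only [map_add, mul_add, ha, hb]
        | hsmul t a ha => simp only [map_smul, mul_smul_comm, ha]
        | hbar h =>
          rw [bar_mul_bar, map_smul, lift_bar, lift_bar, lift_bar]
          ext w
          exact (hα g h w).symm)

/-- The `ℂ^α[G]`-module `W` appears in the representation `ρ` of `ℂ^α[G]` on `M`: it is isomorphic to
a submodule of `M`. -/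
def AppearsIn {M : Type*} [AddCommGroup M] [Module ℂ M]
    (W : Type*) [AddCommGroup W] [Module (TwistedGroupAlgebra α) W]
    (ρ : TwistedGroupAlgebra α →ₐ[ℂ] Module.End ℂ M) : Prop :=
  letI : Module (TwistedGroupAlgebra α) M := Module.compHom M ρ.toRingHom
  ∃ f : W →ₗ[TwistedGroupAlgebra α] M, Function.Injective f

end TwistedGroupAlgebra

end

/-! The operators `φ g` are linearly independent, and this suffices. Given a simple module `W`,
averaging the rank-one maps `x ↦ l x • w` over `G` gives module maps `W → M`, and if they all
vanished the coefficients `l (ḡ⁻¹ x)` would form a linear relation among the `φ g`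
(`appearsIn_of_linearIndependent`).

Independence is Dedekind's argument for characters. Comparing a relation applied to `Y_M(v,z) w`
with `Y_M(a v,z)` times the relation at `w` removes the term of `a` and leaves `∑ c_g Y_M(a v - g v,
z) φ(g) w = 0`. To separate the terms one needs `V ⊗ M → M{z}` to be injective
(`sum_dual_smul_eq_zero`). Its kernel is stable under modes acting on `M`, by weak commutativity.
These modes act densely, by countable dimension, Schur and Jacobson, so a nonzero kernel would yield
a nonzero `u` with `Y_M(u,z) = 0`. Such `u` form a proper ideal of the simple algebra `V`. -/

/-! ### Linear algebra: spectra in countable dimension, and density. -/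

open Polynomial in
/-- **Dixmier's lemma**: an endomorphism of a complex vector space of countable dimension has
non-empty spectrum. -/
theorem exists_not_isUnit_sub_algebraMap {M : Type*} [AddCommGroup M] [Module ℂ M] [Nontrivial M]
    (hM : Module.rank ℂ M ≤ Cardinal.aleph0) (f : Module.End ℂ M) :
    ∃ c : ℂ, ¬ IsUnit (f - algebraMap ℂ (Module.End ℂ M) c) := by
  classical
  by_contra! H
  obtain ⟨w, hw⟩ := exists_ne (0 : M)
  have hunit (p : ℂ[X]) (hp : p ≠ 0) : IsUnit (aeval f p) := by
    rw [(IsAlgClosed.splits p).eq_prod_roots, map_mul, aeval_C]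
    refine IsUnit.mul ((IsUnit.mk0 _ (leadingCoeff_ne_zero.2 hp)).map _) ?_
    generalize p.roots = s
    induction s using Multiset.induction_on with
    | empty => simp
    | cons a s ih =>
      rw [Multiset.map_cons, Multiset.prod_cons, map_mul]
      refine IsUnit.mul ?_ ih
      simpa using H a
  have hinj (p : ℂ[X]) (hp : aeval f p w = 0) : p = 0 := by
    by_contra hne
    exact hw (((Module.End.isUnit_iff _).1 (hunit p hne)).1 (hp.trans (map_zero _).symm))
  -- The vectors `(f - c)⁻¹ w`, for `c ∈ ℂ`, are continuum many; their independence contradicts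
  -- countable dimension.
  choose v hv using fun c => ((Module.End.isUnit_iff _).1 (H c)).2 w
  have hli : LinearIndependent ℂ v := by
    refine linearIndependent_iff'.2 fun s m hm i hi => ?_
    have hq : ∑ j ∈ s, C (m j) * ∏ k ∈ s.erase j, (X - C k) = 0 := by
      refine hinj _ ?_
      -- Multiplying by all the `f - k` clears denominators and turns the relation into a polynomial
      -- in `f` killing `w`.
      have h := congrArg (aeval f (∏ k ∈ s, (X - C k))) hm
      rw [map_zero, map_sum] at h
      rw [map_sum, LinearMap.sum_apply, ← h]
      refine Finset.sum_congr rfl fun j hj => ?_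
      rw [← Finset.prod_erase_mul _ _ hj, map_mul, map_mul, aeval_C, map_smul,
        Module.End.mul_apply, Module.End.mul_apply, Module.algebraMap_end_apply, map_sub, aeval_X,
        aeval_C, hv]
    have h := congrArg (eval i) hq
    rw [eval_finsetSum, eval_zero, Finset.sum_eq_single_of_mem i hi] at h
    · refine (mul_eq_zero.1 (by simpa using h)).resolve_right ?_
      rw [eval_prod]
      refine Finset.prod_ne_zero_iff.2 fun k hk => ?_
      simpa using sub_ne_zero.2 (Finset.ne_of_mem_erase hk).symm
    · intro j _ hji
      rw [eval_mul, eval_prod, Finset.prod_eq_zero (Finset.mem_erase.2 ⟨hji.symm, hi⟩) (by simp),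
        mul_zero]
  have h1 := hli.cardinal_lift_le_rank.trans (Cardinal.lift_le.2 hM)
  rw [Cardinal.mk_complex, Cardinal.lift_continuum, Cardinal.lift_aleph0] at h1
  exact h1.not_gt Cardinal.aleph0_lt_continuum

/-- A simple algebra of operators whose commutant is reduced to the scalars acts densely. -/
theorem exists_mem_eqOn_of_isSimpleModule {M : Type*} [AddCommGroup M] [Module ℂ M]
    (A : Subalgebra ℂ (Module.End ℂ M)) [IsSimpleModule A M]
    (hA : ∀ f : Module.End ℂ M, (∀ a ∈ A, Commute f a) → ∃ c : ℂ, f = algebraMap ℂ _ c)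
    (f : Module.End ℂ M) (s : Finset M) : ∃ a ∈ A, ∀ m ∈ s, a m = f m := by
  have key (e : Module.End A M) : ∃ c : ℂ, ∀ m, e m = c • m := by
    obtain ⟨c, hc⟩ := hA
      { toFun := e
        map_add' := map_add e
        map_smul' := fun c m => (map_smul e (algebraMap ℂ A c) m :) } fun a ha =>
          LinearMap.ext fun m => map_smul e (⟨a, ha⟩ : A) m
    exact ⟨c, fun m => congr($hc m)⟩
  -- The commutant being scalar, every ℂ-linear `f` lies in the bicommutant, where Jacobson density
  -- applies.
  let F : Module.End (Module.End A M) M :=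
    { toFun := f
      map_add' := map_add f
      map_smul' := fun e m => by
        obtain ⟨c, hc⟩ := key e
        simp [hc] }
  obtain ⟨a, ha⟩ := jacobson_density F s
  exact ⟨a, a.2, fun m hm => (ha m hm).symm⟩

/-! ### Eigenspace decomposition of `V` under `σ`. -/

namespace VertexAlgebra

variable {V : Type*} [AddCommGroup V] [Module ℂ V] [VertexAlgebra V] {σ : Aut V}

/-- The eigenspaces of an automorphism of finite order span. -/
theorem exists_sum_sector (hσ : 0 < orderOf σ) (u : V) :
    ∃ f : ℕ → V, (∀ r, f r ∈ sector σ r) ∧ ∑ r ∈ Finset.range (orderOf σ), f r = u := by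
  set T := orderOf σ with hT
  have hT0 : (T : ℂ) ≠ 0 := Nat.cast_ne_zero.2 hσ.ne'
  set ζ : ℂ := Complex.exp (2 * Real.pi * Complex.I / T) with hζ
  have hprim : IsPrimitiveRoot ζ T := Complex.isPrimitiveRoot_exp T hσ.ne'
  have hζ0 : ζ ≠ 0 := Complex.exp_ne_zero _
  have hexp (r : ℕ) : Complex.exp (-2 * Real.pi * Complex.I * r / T) = (ζ ^ r)⁻¹ := by
    rw [hζ, ← Complex.exp_nat_mul, ← Complex.exp_neg]
    congr 1
    ring
  let τ : ℕ → V := fun k => ((σ ^ k : Aut V) : V ≃ₗ[ℂ] V) u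
  have hτ (k : ℕ) : (σ : V ≃ₗ[ℂ] V) (τ k) = τ (k + 1) := by
    simp only [τ, pow_succ']
    rfl
  have hτT : τ T = τ 0 := by simp only [τ, hT, pow_orderOf_eq_one, pow_zero]
  have hτ0 : τ 0 = u := by simp only [τ, pow_zero]; rfl
  -- Discrete Fourier projection; the weight is `ζ ^ (k * r)` because the eigenvalue on the sector
  -- is `ζ ^ (-r)`.
  refine ⟨fun r => (T : ℂ)⁻¹ • ∑ k ∈ Finset.range T, (ζ ^ k) ^ r • τ k, fun r => ?_, ?_⟩
  · refine Module.End.mem_eigenspace_iff.2 ?_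
    rw [← hT, hexp, LinearEquiv.coe_coe, map_smul, smul_comm, map_sum, Finset.smul_sum]
    have h1 (k : ℕ) : (σ : V ≃ₗ[ℂ] V) ((ζ ^ k) ^ r • τ k)
        = (ζ ^ r)⁻¹ • ((ζ ^ (k + 1)) ^ r • τ (k + 1)) := by
      rw [map_smul, hτ, smul_smul]
      congr 1
      field_simp
      ring
    simp only [h1]
    rw [← Finset.smul_sum, ← Finset.smul_sum]
    congr 1
    -- The summand has period `T` in `k`, so shifting the index leaves the sum unchanged.
    have h2 := Finset.sum_range_succ (fun k => (ζ ^ k) ^ r • τ k) T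
    rw [Finset.sum_range_succ', hτT, hprim.pow_eq_one, pow_zero] at h2
    exact congrArg _ (add_right_cancel h2)
  · rw [← Finset.smul_sum, Finset.sum_comm]
    have h1 (k : ℕ) (hk : k ∈ Finset.range T) (hk0 : k ≠ 0) :
        ∑ r ∈ Finset.range T, (ζ ^ k) ^ r • τ k = 0 := by
      rw [← Finset.sum_smul, geom_sum_eq (hprim.pow_ne_one_of_pos_of_lt hk0 (Finset.mem_range.1 hk)),
        ← pow_mul, mul_comm, pow_mul, hprim.pow_eq_one, one_pow, sub_self, zero_div, zero_smul]
    rw [Finset.sum_eq_single_of_mem 0 (Finset.mem_range.2 hσ) h1]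
    simp [hτ0, smul_smul, hT0, ← Nat.cast_smul_eq_nsmul ℂ]

theorem sector_induction (hσ : 0 < orderOf σ) {p : V → Prop} (hadd : ∀ u v, p u → p v → p (u + v))
    (hsector : ∀ r < orderOf σ, ∀ u ∈ sector σ r, p u) (u : V) : p u := by
  obtain ⟨f, hf, rfl⟩ := exists_sum_sector hσ u
  exact Finset.sum_induction _ _ hadd (hsector 0 hσ 0 (zero_mem _))
    fun r hr => hsector r (Finset.mem_range.1 hr) _ (hf r)

end VertexAlgebra

/-! ### Faithfulness of the twisted module. -/

namespace TwistedModule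

open VertexAlgebra

variable {V : Type*} [AddCommGroup V] [Module ℂ V] [VertexAlgebra V] {σ : Aut V}
  {M : Type*} [AddCommGroup M] [Module ℂ M] (Y : TwistedModule V σ M)

/-- Modes of different sectors live on disjoint cosets `r/T + ℤ`, so they cannot cancel. The twisted
Jacobi identity, available only for homogeneous `u`, can thus be used on any element of the kernel.
-/
theorem mode_eq_zero_of_sum (hσ : 0 < orderOf σ) {f : ℕ → V} (hf : ∀ r, f r ∈ sector σ r)
    (h : Y.mode (∑ r ∈ Finset.range (orderOf σ), f r) = 0) {r : ℕ} (hr : r < orderOf σ) :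
    Y.mode (f r) = 0 := by
  funext n
  by_cases hn : ∃ k : ℤ, n = (r : ℚ) / (orderOf σ : ℚ) + k
  · have h1 := congrFun h n
    rw [map_sum, Finset.sum_apply, Finset.sum_eq_single_of_mem r (Finset.mem_range.2 hr)] at h1
    · exact h1
    · intro s hs hsr
      refine Y.support s (Finset.mem_range.1 hs) _ (hf s) n ?_
      rintro ⟨k', hk'⟩
      obtain ⟨k, hk⟩ := hn
      have hT : (orderOf σ : ℚ) ≠ 0 := Nat.cast_ne_zero.2 hσ.ne'
      rw [hk] at hk'
      field_simp at hk'
      have h2 : (r : ℤ) + orderOf σ * k = s + orderOf σ * k' := by exact_mod_cast hk'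
      have h3 := congrArg (· % (orderOf σ : ℤ)) h2
      simp only [Int.add_mul_emod_self_left] at h3
      rw [Int.emod_eq_of_lt (by positivity) (by exact_mod_cast hr),
        Int.emod_eq_of_lt (by positivity) (by exact_mod_cast Finset.mem_range.1 hs)] at h3
      exact hsr (by exact_mod_cast h3.symm)
  · exact Y.support r hr _ (hf r) n hn

theorem mode_mode_eq_zero_of_mem_sector {r : ℕ} (hr : r < orderOf σ) {u : V} (hu : u ∈ sector σ r)
    (v : V) (h : Y.mode u = 0 ∨ Y.mode v = 0) (l : ℤ) :
    Y.mode (VertexAlgebra.mode u l v) = 0 := by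
  obtain ⟨L, hL⟩ := VertexAlgebra.truncation u v
  have key (k : ℕ) : ∀ l : ℤ, L ≤ l + k → Y.mode (VertexAlgebra.mode u l v) = 0 := by
    induction k with
    | zero => intro l hl; rw [hL l (by simpa using hl), map_zero]
    | succ k ih =>
      intro l hl
      funext q
      ext w
      -- The left side vanishes. On the right, the terms `j ≥ 1` involve `u_{l+j} v`, already
      -- treated by descending induction on `l`; only `j = 0` survives.
      have hj := Y.jacobi r hr u hu v w l (r / orderOf σ : ℚ) (q - r / orderOf σ) ⟨0, by simp⟩
      rw [finsum_eq_zero_of_forall_eq_zero, finsum_eq_single _ 0] at hj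
      · simpa using hj.symm
      · intro j hj0
        rw [ih (l + j) (by push_cast at hl; lia)]
        simp
      · intro i
        rcases h with h | h <;> simp [h]
  exact key (L - l).toNat l (by lia)

/-- The kernel of `v ↦ Y_M(v,z)` is an ideal. -/
theorem isIdeal_ker_mode (hσ : 0 < orderOf σ) : IsIdeal (LinearMap.ker Y.mode) := by
  intro v n w hw
  rw [LinearMap.mem_ker] at hw
  simp only [LinearMap.mem_ker]
  constructor
  · induction v using sector_induction hσ with
    | hadd u v hu hv => simp [hu, hv]
    | hsector r hr u hu => exact Y.mode_mode_eq_zero_of_mem_sector hr hu w (.inr hw) n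
  · obtain ⟨f, hf, rfl⟩ := exists_sum_sector hσ w
    rw [map_sum, Finset.sum_apply, LinearMap.sum_apply, map_sum]
    refine Finset.sum_eq_zero fun r hr => ?_
    have hr := Finset.mem_range.1 hr
    exact Y.mode_mode_eq_zero_of_mem_sector hr (hf r) v (.inl (Y.mode_eq_zero_of_sum hσ hf hw hr)) n

theorem mode_injective (hV : VertexAlgebra.IsSimple V) (hσ : 0 < orderOf σ) [Nontrivial M] :
    Function.Injective Y.mode := by
  refine LinearMap.ker_eq_bot.1 ((hV.2 _ (Y.isIdeal_ker_mode hσ)).resolve_right fun h => ?_)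
  obtain ⟨w, hw⟩ := exists_ne (0 : M)
  have h1 : Y.mode vacuum = 0 := LinearMap.mem_ker.1 (h ▸ Submodule.mem_top)
  have h2 := Y.vacuum_mode (-1) w
  rw [h1, if_pos rfl] at h2
  exact hw h2.symm

/-! ### Weak commutativity and stability of the kernel of `V ⊗ M → M{z}`. -/

/-- Weak commutativity of the vertex operators. -/
theorem exists_weak_comm (hσ : 0 < orderOf σ) (u v : V) : ∃ N₀ : ℕ, ∀ N ≥ N₀, ∀ (m n : ℚ) (w : M),
    ∑ i ∈ Finset.range (N + 1), ((-1 : ℂ) ^ i * (N.choose i : ℂ)) •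
        Y.mode u (m + N - i) (Y.mode v (n + i) w)
      = ∑ i ∈ Finset.range (N + 1), ((-1 : ℂ) ^ i * (N.choose i : ℂ)) •
        ((-1 : ℂ) ^ N • Y.mode v (n + N - i) (Y.mode u (m + i) w)) := by
  induction u using sector_induction hσ with
  | hadd u u' hu hu' =>
    obtain ⟨N₁, h₁⟩ := hu
    obtain ⟨N₂, h₂⟩ := hu'
    refine ⟨max N₁ N₂, fun N hN m n w => ?_⟩
    simp only [map_add, Pi.add_apply, LinearMap.add_apply, smul_add, Finset.sum_add_distrib]
    rw [h₁ N (le_of_max_le_left hN), h₂ N (le_of_max_le_right hN)]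
  | hsector r hr u hu =>
    obtain ⟨L, hL⟩ := VertexAlgebra.truncation u v
    refine ⟨L.toNat, fun N hN m n w => ?_⟩
    by_cases hm : ∃ k : ℤ, m = (r : ℚ) / (orderOf σ : ℚ) + k
    · have hj := Y.jacobi r hr u hu v w N m n hm
      rw [finsum_eq_sum_of_support_subset (s := Finset.range (N + 1)),
        finsum_eq_zero_of_forall_eq_zero fun j => by rw [hL _ (by lia)]; simp] at hj
      · simpa [Ring.choose_natCast, smul_sub, sub_eq_zero] using hj
      · intro i hi
        by_contra hi'
        refine hi ?_
        have : N < i := by simpa using hi'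
        simp [Ring.choose_natCast, Nat.choose_eq_zero_of_lt this]
    · have h0 (q : ℚ) (k : ℤ) (hq : q = m + k) : Y.mode u q = 0 := by
        refine Y.support r hr u hu q ?_
        rintro ⟨k', hk'⟩
        refine hm ⟨k' - k, ?_⟩
        push_cast
        linarith
      rw [Finset.sum_eq_zero, Finset.sum_eq_zero]
      · intro i _
        rw [h0 (m + i) i (by simp)]
        simp
      · intro i _
        rw [h0 (m + N - i) (N - i) (by push_cast; ring)]
        simp

/-- Weak commutativity with a common `N` lets `v` move to the left, where the hypothesis applies, at
the cost of a factor `(z₁ - z₂)^N`. Truncation of `v` on the `w i` starts a descending induction on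
`n` that cancels this factor. -/
theorem sum_mode_mode_eq_zero (hσ : 0 < orderOf σ) {ι : Type*} (s : Finset ι) (u : ι → V)
    (w : ι → M) (h : ∀ n, ∑ i ∈ s, Y.mode (u i) n (w i) = 0) (v : V) (n m : ℚ) :
    ∑ i ∈ s, Y.mode (u i) m (Y.mode v n (w i)) = 0 := by
  choose N₀ hN₀ using fun i => Y.exists_weak_comm hσ (u i) v
  choose B hB using fun i => Y.truncation v (w i)
  obtain ⟨N, hN⟩ := (s.image N₀).exists_le
  obtain ⟨C, hC⟩ := (s.image B).exists_le
  simp only [Finset.forall_mem_image] at hN hC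
  have key (k : ℕ) : ∀ n m : ℚ, C ≤ n + k → ∑ i ∈ s, Y.mode (u i) m (Y.mode v n (w i)) = 0 := by
    induction k with
    | zero =>
      intro n m hn
      refine Finset.sum_eq_zero fun i hi => ?_
      rw [hB i n ((hC hi).trans (by simpa using hn)), map_zero]
    | succ k ih =>
      intro n m hn
      -- The shift `m - N` makes the term of index `0` equal to `u_m v_n`; the others have `v_{n+j}`
      -- with `j ≥ 1`.
      have h1 := Finset.sum_congr (rfl : s = s) fun i hi => hN₀ i N (hN hi) (m - N) n (w i)
      rw [Finset.sum_comm, Finset.sum_comm (s := s)] at h1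
      simp only [← Finset.smul_sum, ← map_sum, h, map_zero, smul_zero, Finset.sum_const_zero] at h1
      rw [Finset.sum_eq_single_of_mem 0 (by simp)] at h1
      · simpa using h1
      · intro j _ hj
        have hj1 : (1 : ℚ) ≤ j := by exact_mod_cast Nat.one_le_iff_ne_zero.2 hj
        rw [ih _ _ (by push_cast at hn; linarith), smul_zero]
  obtain ⟨k, hk⟩ := exists_nat_ge (C - n)
  exact key k n m (by linarith)

/-! ### Irreducible modules: countability, Schur, and injectivity on `V ⊗ M`. -/

/-- The algebra of operators generated by the modes. -/
noncomputable def modeAlgebra : Subalgebra ℂ (Module.End ℂ M) :=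
  Algebra.adjoin ℂ {a | ∃ v n, a = Y.mode v n}

variable {Y} in
theorem IsIrreducible.isSimpleModule (hY : Y.IsIrreducible) : IsSimpleModule Y.modeAlgebra M := by
  have := hY.1
  refine @IsSimpleModule.mk _ _ _ _ _ ⟨fun P => ?_⟩
  rcases hY.2 (P.restrictScalars ℂ) fun v n w hw =>
    P.smul_mem (⟨Y.mode v n, Algebra.subset_adjoin ⟨v, n, rfl⟩⟩ : Y.modeAlgebra) hw with h | h
  · exact .inl (by simpa using h)
  · exact .inr (by simpa using h)

variable {Y} in
theorem IsIrreducible.rank_le (hY : Y.IsIrreducible) (hV : Module.rank ℂ V ≤ Cardinal.aleph0) :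
    Module.rank ℂ M ≤ Cardinal.aleph0 := by
  have := hY.1
  obtain ⟨w, hw⟩ := exists_ne (0 : M)
  let b := Module.Basis.ofVectorSpace ℂ V
  have hb : Countable (Module.Basis.ofVectorSpaceIndex ℂ V) := by
    rw [← Cardinal.mk_le_aleph0_iff, b.mk_eq_rank'']
    exact hV
  -- Words in the modes of a countable basis, with rational indices, applied to one nonzero vector:
  -- a countable spanning set.
  let f : List (Module.Basis.ofVectorSpaceIndex ℂ V × ℚ) → M :=
    fun l => (l.map fun p => Y.mode (b p.1) p.2).prod w
  have htop : Submodule.span ℂ (Set.range f) = ⊤ := by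
    refine (hY.2 _ fun v n x hx => ?_).resolve_left fun h => ?_
    · rw [← b.linearCombination_repr v, Finsupp.linearCombination_apply, Finsupp.sum, map_sum,
        Finset.sum_apply, LinearMap.sum_apply]
      refine sum_mem fun i _ => ?_
      rw [map_smul, Pi.smul_apply, LinearMap.smul_apply]
      refine Submodule.smul_mem _ _ ?_
      induction hx using Submodule.span_induction with
      | mem x hx =>
        obtain ⟨l, rfl⟩ := hx
        refine Submodule.subset_span ⟨(i, n) :: l, ?_⟩
        simp [f]
      | zero => simp
      | add x y _ _ hx hy => rw [map_add]; exact add_mem hx hy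
      | smul c x _ hx => rw [map_smul]; exact Submodule.smul_mem _ _ hx
    · have h1 : w ∈ Submodule.span ℂ (Set.range f) := Submodule.subset_span ⟨[], by simp [f]⟩
      rw [h] at h1
      exact hw ((Submodule.mem_bot ℂ).1 h1)
  rw [← rank_top, ← htop]
  exact (rank_span_le _).trans (Cardinal.mk_le_aleph0_iff.2 (Set.countable_range f).to_subtype)

variable {Y} in
/-- **Schur's lemma** for irreducible twisted modules of countable dimension. -/
theorem IsIrreducible.exists_eq_algebraMap (hY : Y.IsIrreducible)
    (hV : Module.rank ℂ V ≤ Cardinal.aleph0) (f : Module.End ℂ M)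
    (hf : ∀ v n w, f (Y.mode v n w) = Y.mode v n (f w)) : ∃ c : ℂ, f = algebraMap ℂ _ c := by
  have := hY.1
  obtain ⟨c, hc⟩ := exists_not_isUnit_sub_algebraMap (hY.rank_le hV) f
  refine ⟨c, ?_⟩
  set g := f - algebraMap ℂ (Module.End ℂ M) c with hg
  have hgm (v : V) (n : ℚ) (w : M) : g (Y.mode v n w) = Y.mode v n (g w) := by
    simp [hg, hf, Module.algebraMap_end_apply]
  rw [← sub_eq_zero, ← hg]
  by_contra hg0
  refine hc ((Module.End.isUnit_iff _).2 ⟨?_, ?_⟩)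
  · refine LinearMap.ker_eq_bot.1 ((hY.2 _ fun v n w hw => ?_).resolve_right fun h => ?_)
    · rw [LinearMap.mem_ker] at hw ⊢
      rw [hgm, hw, map_zero]
    · exact hg0 (LinearMap.ker_eq_top.1 h)
  · refine LinearMap.range_eq_top.1 ((hY.2 _ fun v n w hw => ?_).resolve_left fun h => ?_)
    · obtain ⟨x, rfl⟩ := hw
      exact ⟨_, hgm v n x⟩
    · exact hg0 (LinearMap.range_eq_bot.1 h)

variable {Y} in
/-- Injectivity of `V ⊗ M → M{z}`, `v ⊗ w ↦ Y_M(v,z) w`, tested on functionals on `V`. -/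
theorem IsIrreducible.sum_dual_smul_eq_zero (hY : Y.IsIrreducible) (hVs : VertexAlgebra.IsSimple V)
    (hV : Module.rank ℂ V ≤ Cardinal.aleph0) (hσ : 0 < orderOf σ) {ι : Type*} (s : Finset ι)
    (u : ι → V) (w : ι → M) (h : ∀ n, ∑ i ∈ s, Y.mode (u i) n (w i) = 0) (l : Module.Dual ℂ V) :
    ∑ i ∈ s, l (u i) • w i = 0 := by
  classical
  have := hY.1
  have := hY.isSimpleModule
  have hstab (a : Module.End ℂ M) (ha : a ∈ Y.modeAlgebra) :
      ∀ w : ι → M, (∀ n, ∑ i ∈ s, Y.mode (u i) n (w i) = 0) →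
        ∀ n, ∑ i ∈ s, Y.mode (u i) n (a (w i)) = 0 := by
    induction ha using Algebra.adjoin_induction with
    | mem a ha =>
      obtain ⟨v, m, rfl⟩ := ha
      exact fun w hw n => Y.sum_mode_mode_eq_zero hσ s u w hw v m n
    | algebraMap c =>
      intro w hw n
      simp [Module.algebraMap_end_apply, ← Finset.smul_sum, hw]
    | add a b _ _ ha hb =>
      intro w hw n
      simp [Finset.sum_add_distrib, ha w hw, hb w hw]
    | mul a b _ _ ha hb => exact fun w hw n => ha _ (hb w hw) n
  let b := Module.Basis.ofVectorSpace ℂ M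
  have key (j) : ∑ i ∈ s, b.repr (w i) j • u i = 0 := by
    refine Y.mode_injective hVs hσ ?_
    rw [map_zero]
    funext n
    ext t
    -- The mode algebra imitates the rank-one map `x ↦ b_j(x) t` on all the `w i`, isolating one
    -- coordinate of the tensor.
    obtain ⟨a, ha, haw⟩ := exists_mem_eqOn_of_isSimpleModule Y.modeAlgebra
      (fun f hf => hY.exists_eq_algebraMap hV f fun v n w =>
        congr($((hf _ (Algebra.subset_adjoin ⟨v, n, rfl⟩)).eq) w))
      ((b.coord j).smulRight t) (s.image w)
    have h1 := hstab a ha w h n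
    rw [Finset.sum_congr rfl fun i hi => by rw [haw _ (Finset.mem_image_of_mem w hi)]] at h1
    simpa using h1
  refine b.ext_elem fun j => ?_
  simpa [mul_comm] using congrArg l (key j)

end TwistedModule

/-! ### Simple modules of the twisted group algebra. -/

namespace TwistedGroupAlgebra

variable {G : Type*} [Group G] {α : TwoCocycle G}

theorem isUnit_bar (g : G) : IsUnit (bar α g) := by
  rw [isUnit_iff_exists_and_exists]
  refine ⟨⟨((α.val g g⁻¹)⁻¹ : ℂˣ).val • bar α g⁻¹, ?_⟩, ⟨((α.val g⁻¹ g)⁻¹ : ℂˣ).val • bar α g⁻¹, ?_⟩⟩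
  · rw [mul_smul_comm, bar_mul_bar, smul_smul, Units.inv_mul, one_smul, mul_inv_cancel, one_def]
  · rw [smul_mul_assoc, bar_mul_bar, smul_smul, Units.inv_mul, one_smul, inv_mul_cancel, one_def]

@[simp] theorem rep_bar {M : Type*} [AddCommGroup M] [Module ℂ M] (φ : G → (M ≃ₗ[ℂ] M))
    (h1 : φ 1 = LinearEquiv.refl ℂ M)
    (hα : ∀ (g h : G) (w : M), φ g (φ h w) = (α.val g h : ℂ) • φ (g * h) w) (g : G) (w : M) :
    rep φ h1 hα (bar α g) w = φ g w := by
  have h : rep φ h1 hα (bar α g) = (φ g : Module.End ℂ M) := lift_bar _ g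
  rw [h]
  rfl

/-- If the operators `φ g` are linearly independent then every simple module of the twisted group
algebra appears in the projective representation `φ`. -/
theorem appearsIn_of_linearIndependent [Finite G] {M : Type*} [AddCommGroup M] [Module ℂ M]
    (φ : G → (M ≃ₗ[ℂ] M)) (h1 : φ 1 = LinearEquiv.refl ℂ M)
    (hα : ∀ (g h : G) (w : M), φ g (φ h w) = (α.val g h : ℂ) • φ (g * h) w)
    (hφ : LinearIndependent ℂ fun g => (φ g : Module.End ℂ M))
    (W : Type*) [AddCommGroup W] [Module (TwistedGroupAlgebra α) W]
    [IsSimpleModule (TwistedGroupAlgebra α) W] : AppearsIn W (rep φ h1 hα) := by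
  cases nonempty_fintype G
  let : Module (TwistedGroupAlgebra α) M := Module.compHom M (rep φ h1 hα).toRingHom
  let : Module ℂ W := Module.compHom W (algebraMap ℂ (TwistedGroupAlgebra α))
  have hsmulM (a : TwistedGroupAlgebra α) (w : M) : a • w = rep φ h1 hα a w := rfl
  have : IsScalarTower ℂ (TwistedGroupAlgebra α) W := ⟨fun c a x => by
    rw [Algebra.smul_def, mul_smul]
    rfl⟩
  choose ub hub using isUnit_bar (α := α)
  have hinv (h k : G) : ((ub (h * k))⁻¹ : (TwistedGroupAlgebra α)ˣ).val * bar α h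
      = (α.val h k : ℂ) • ((ub k)⁻¹ : (TwistedGroupAlgebra α)ˣ).val := by
    rw [Units.inv_mul_eq_iff_eq_mul, mul_smul_comm, ← smul_mul_assoc, Units.eq_mul_inv_iff_mul_eq,
      hub, hub, bar_mul_bar]
  -- The average of `x ↦ l x • w` over `G`. Equivariance under `h̄` is the substitution `g = h k`,
  -- with `hinv` supplying the cocycle factor.
  let F (l : Module.Dual ℂ W) (w : M) : W →ₗ[TwistedGroupAlgebra α] M :=
    { toFun := fun x => ∑ g, l (((ub g)⁻¹ : (TwistedGroupAlgebra α)ˣ).val • x) • φ g w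
      map_add' := fun x y => by simp only [smul_add, map_add, add_smul, Finset.sum_add_distrib]
      map_smul' := fun a x => by
        rw [RingHom.id_apply, hsmulM]
        induction a using induction_bar with
        | hadd a b ha hb =>
          simp only [add_smul, smul_add, map_add, Finset.sum_add_distrib, ha, hb,
            LinearMap.add_apply]
        | hsmul c a ha =>
          rw [map_smul, LinearMap.smul_apply, ← ha, Finset.smul_sum]
          refine Finset.sum_congr rfl fun g _ => ?_
          rw [smul_assoc c a x, ← algebraMap_smul (TwistedGroupAlgebra α) c (a • x), smul_smul,
            ← Algebra.commutes, mul_smul, algebraMap_smul, map_smul, smul_eq_mul, mul_smul]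
        | hbar h =>
          rw [rep_bar, map_sum, ← Equiv.sum_comp (Equiv.mulLeft h)]
          refine Finset.sum_congr rfl fun k _ => ?_
          rw [Equiv.coe_mulLeft, smul_smul, hinv, smul_assoc, map_smul l, map_smul (φ h), hα,
            smul_eq_mul, mul_comm, mul_smul] }
  have hex : ∃ l w, F l w ≠ 0 := by
    by_contra! H
    have := IsSimpleModule.nontrivial (TwistedGroupAlgebra α) W
    obtain ⟨x, hx⟩ := exists_ne (0 : W)
    refine hx (((ub 1)⁻¹).isUnit.smul_eq_zero.1 ((Module.forall_dual_apply_eq_zero_iff ℂ _).1 fun l =>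
      Fintype.linearIndependent_iff.1 hφ
        (fun g => l (((ub g)⁻¹ : (TwistedGroupAlgebra α)ˣ).val • x)) ?_ 1))
    ext w
    have h := congr($(H l w) x)
    simpa [F] using h
  obtain ⟨l, w, hlw⟩ := hex
  exact ⟨F l w, LinearMap.injective_of_ne_zero hlw⟩

end TwistedGroupAlgebra

/-! ### The projective action of `G`, and the conclusion. -/

namespace TwistedModule

open VertexAlgebra

variable {V : Type*} [AddCommGroup V] [Module ℂ V] [VertexAlgebra V] {σ : Aut V}
  {M : Type*} [AddCommGroup M] [Module ℂ M] {Y : TwistedModule V σ M}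

theorem IsGStable.exists_isIntertwiningFamily {G : Subgroup (Aut V)}
    {hσ : ∀ g ∈ G, Commute g σ} (h : Y.IsGStable G hσ) :
    ∃ φ : G → (M ≃ₗ[ℂ] M), Y.IsIntertwiningFamily G φ := by
  classical
  choose f hf using fun g : G => h g g.2
  -- The isomorphism chosen at `1` is arbitrary and is replaced by the identity.
  refine ⟨fun g => if g = 1 then LinearEquiv.refl ℂ M else f g, if_pos rfl, fun g v n w => ?_⟩
  dsimp only
  split_ifs with hg
  · subst hg
    rfl
  · exact hf g v n w

variable {G : Subgroup (Aut V)} {φ : G → (M ≃ₗ[ℂ] M)}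

/-- By Schur, `φ(g) φ(h) φ(gh)⁻¹`, which commutes with all modes, is a scalar; associativity of
composition gives the cocycle identity. -/
theorem IsIntertwiningFamily.exists_twoCocycle (hφ : Y.IsIntertwiningFamily G φ)
    (hY : Y.IsIrreducible) (hV : Module.rank ℂ V ≤ Cardinal.aleph0) :
    ∃ α : TwoCocycle G, ∀ (g h : G) (w : M), φ g (φ h w) = (α.val g h : ℂ) • φ (g * h) w := by
  have := hY.1
  obtain ⟨w₀, hw₀⟩ := exists_ne (0 : M)
  have hne (g : G) : φ g w₀ ≠ 0 := (φ g).map_ne_zero_iff.2 hw₀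
  have key (g h : G) : ∃ c : ℂˣ, ∀ w, φ g (φ h w) = (c : ℂ) • φ (g * h) w := by
    obtain ⟨c, hc⟩ := hY.exists_eq_algebraMap hV
      (((φ (g * h)).symm.trans ((φ h).trans (φ g)) : M ≃ₗ[ℂ] M) : Module.End ℂ M) fun v n w => by
        obtain ⟨x, rfl⟩ := (φ (g * h)).surjective w
        obtain ⟨v, rfl⟩ := (((g * h : G) : Aut V) : V ≃ₗ[ℂ] V).surjective v
        have e := hφ.2 (g * h) v n x
        rw [← e]
        simp only [LinearEquiv.coe_coe, LinearEquiv.trans_apply, LinearEquiv.symm_apply_apply]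
        rw [hφ.2, hφ.2]
        rfl
    have hc' (w : M) : φ g (φ h w) = c • φ (g * h) w := by
      simpa [Module.algebraMap_end_apply] using congr($hc (φ (g * h) w))
    have hc0 : c ≠ 0 := by
      rintro rfl
      have h0 := hc' w₀
      rw [zero_smul, LinearEquiv.map_eq_zero_iff] at h0
      exact hne h h0
    exact ⟨Units.mk0 c hc0, hc'⟩
  choose a ha using key
  refine ⟨⟨a, fun g => ?_, fun g => ?_, fun g h k => ?_⟩, ha⟩
  · have h0 := ha 1 g w₀
    rw [hφ.1, LinearEquiv.refl_apply, one_mul] at h0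
    exact Units.ext (smul_left_injective ℂ (hne g) (by simpa using h0.symm))
  · have h0 := ha g 1 w₀
    rw [hφ.1, LinearEquiv.refl_apply, mul_one] at h0
    exact Units.ext (smul_left_injective ℂ (hne g) (by simpa using h0.symm))
  · have h0 : φ g (φ h (φ k w₀)) = _ := ha g h (φ k w₀)
    rw [ha h k w₀, map_smul, ha, ha, smul_smul, smul_smul, ← mul_assoc] at h0
    exact Units.ext (smul_left_injective ℂ (hne (g * h * k)) (by simpa using h0.symm))

/-- The operators `φ(g)` are linearly independent. -/
theorem IsIntertwiningFamily.linearIndependent (hφ : Y.IsIntertwiningFamily G φ)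
    (hY : Y.IsIrreducible) (hVs : VertexAlgebra.IsSimple V)
    (hV : Module.rank ℂ V ≤ Cardinal.aleph0) (hσ : 0 < orderOf σ) :
    LinearIndependent ℂ fun g => (φ g : Module.End ℂ M) := by
  classical
  have := hY.1
  obtain ⟨w₀, hw₀⟩ := exists_ne (0 : M)
  rw [linearIndependent_iff']
  intro s
  induction s using Finset.induction_on with
  | empty => simp
  | insert a s has ih =>
    intro c hc
    have hcw (w : M) : ∑ g ∈ insert a s, c g • φ g w = 0 := by simpa using congr($hc w)
    have hs (g : G) (hg : g ∈ s) : c g = 0 := by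
      by_contra hcg
      refine has (?_ : a ∈ s)
      -- If `c g ≠ 0`, the shortened relation forces `l (a v - g v) = 0` for all `l` and `v`, so `a
      -- = g`.
      suffices a = g from this ▸ hg
      refine Subtype.ext (Subtype.ext (LinearEquiv.ext fun v => ?_))
      rw [← sub_eq_zero]
      refine (Module.forall_dual_apply_eq_zero_iff ℂ _).1 fun l => ?_
      let u : G → V := fun g =>
        (((a : G) : Aut V) : V ≃ₗ[ℂ] V) v - (((g : G) : Aut V) : V ≃ₗ[ℂ] V) v
      suffices h : c g * l (u g) = 0 from (mul_eq_zero.1 h).resolve_left hcg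
      refine ih (fun g => c g * l (u g)) (LinearMap.ext fun w => ?_) g hg
      have h1 := hY.sum_dual_smul_eq_zero hVs hV hσ (insert a s) u (fun g => c g • φ g w)
        (fun n => by
          simp only [u, map_sub, Pi.sub_apply, LinearMap.sub_apply, Finset.sum_sub_distrib]
          rw [← map_sum, hcw, map_zero, zero_sub, neg_eq_zero]
          simpa only [map_smul, hφ.2] using hcw (Y.mode v n w)) l
      rw [Finset.sum_insert has] at h1
      simpa [u, smul_smul, mul_comm] using h1
    intro g hg
    rcases Finset.mem_insert.1 hg with rfl | hg
    · have h1 := hcw w₀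
      rw [Finset.sum_insert has, Finset.sum_eq_zero fun i hi => by rw [hs i hi, zero_smul],
        add_zero] at h1
      exact (smul_eq_zero.1 h1).resolve_right ((φ g).map_ne_zero_iff.2 hw₀)
    · exact hs g hg

end TwistedModule

theorem corollary6
    {V : Type*} [AddCommGroup V] [Module ℂ V] [VertexAlgebra V]
    (hVsimple : VertexAlgebra.IsSimple V) (hVcount : Module.rank ℂ V ≤ Cardinal.aleph0)
    (G : Subgroup (VertexAlgebra.Aut V)) [Finite G]
    (σ : VertexAlgebra.Aut V) (hσG : σ ∈ G) (hσ : ∀ g ∈ G, Commute g σ)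
    {M : Type*} [AddCommGroup M] [Module ℂ M]
    (Y : TwistedModule V σ M) (hirr : Y.IsIrreducible) (hstable : Y.IsGStable G hσ) :
    (∃ φ : G → (M ≃ₗ[ℂ] M), Y.IsIntertwiningFamily G φ) ∧
    ∀ (φ : G → (M ≃ₗ[ℂ] M)) (hφ : Y.IsIntertwiningFamily G φ),
      ∃ (α : TwoCocycle G)
        (hα : ∀ (g h : G) (w : M), φ g (φ h w) = (α.val g h : ℂ) • φ (g * h) w),
        ∀ (W : Type*) [AddCommGroup W] [Module (TwistedGroupAlgebra α) W]
          [IsSimpleModule (TwistedGroupAlgebra α) W],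
          TwistedGroupAlgebra.AppearsIn W (TwistedGroupAlgebra.rep φ hφ.1 hα) := by
  -- Finiteness of `G` excludes the default value `orderOf σ = 0`, for which `support` and `jacobi`
  -- would be void.
  have hσ0 : 0 < orderOf σ := by
    have h := orderOf_pos (⟨σ, hσG⟩ : G)
    rwa [Subgroup.orderOf_mk] at h
  refine ⟨hstable.exists_isIntertwiningFamily, fun φ hφ => ?_⟩
  obtain ⟨α, hα⟩ := hφ.exists_twoCocycle hirr hVcount
  refine ⟨α, hα, fun W _ _ _ => ?_⟩
  exact TwistedGroupAlgebra.appearsIn_of_linearIndependent φ hφ.1 hα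
    (hφ.linearIndependent hirr hVsimple hVcount hσ0) W
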